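/- Write $z=x+iy\in\mathbb{C}^n$ with $x,y\in\mathbb{R}^n$. A closed set $K\subset\mathbb{C}^n$ is called a *(smooth, closed) strongly pseudoconvex domain* if $K=\{\rho\le 0\}$ for a $C^\infty$ strongly plurisubharmonic function $\rho$ on an open set containing $K$, with $bK=\{\rho=0\}$ and $d\rho\neq 0$ on $bK$. A smooth submanifold $M\subset\mathbb{C}^n$ with boundary $bM$ is a *totally real handle* attached to such a domain $D$ if $T_pM\cap J\,T_pM=\{0\}$ for all $p\in M$, and $S:=M\cap D$ is contained in $bD$, is a union of connected components of $bM$, and satisfies $T_pS\subset T_p(bD)\cap J\,T_p(bD)$ for all $p\in S$. Given such $D$, $M$ and an open set $U\supset M$, a *smooth strongly pseudoconvex handlebody with center $D\cup M$* (inside $D\cup U$) is a smooth closed strongly pseudoconvex domain $K$ with $D\cup M\subset K\subset D\cup U$ which admits a strong deformation retraction onto $D\cup M$. **Corollary 3.2.** Let $\lambda>1$, $a>0$, $g(t)=\sqrt{\lambda t^2+a}$, $0<\sigma<\epsilon$, and let $f\colon[\sigma,+\infty)\to[f(\sigma),+\infty)$ be a continuous, positive, strictly increasing function which is $C^\infty$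 on $(\sigma,+\infty)$, satisfies $$ f\cdot\Bigl(f''+\frac{f'^3}{t}\Bigr)>1,\qquad \frac{ff'}{t}>1\qquad (t>\sigma), $$ and has the following properties: (i) $f(t)=g(t)$ for $t\ge\epsilon$; (ii) $f(t)<g(t)$ for $\sigma\le t<\epsilon$; (iii) $\lim_{t\downarrow\sigma}f'(t)=+\infty$; (iv) the inverse function, extended by $f^{-1}(u)=\sigma$ for $0\le u\le f(\sigma)$, is a $C^\infty$ function $h=f^{-1}\colon[0,+\infty)\to[\sigma,+\infty)$ and satisfies $h\,(h''+h'^3/u)<1$ and $hh'/u<1$ for $u>0$. Let $D=\{x+iy\in\mathbb{C}^n: |y|^2\ge\lambda|x|^2+a\}$ and $M=\{iy: y\in\mathbb{R}^n,\ |y|\le\sqrt a\}$. Then $D$ is a smooth closed strongly pseudoconvex domain, $M$ is a totally real handle attached to $D$, and $$K=\{x+iy\in\mathbb{C}^n: |x|\le f^{-1}(|y|)\}$$ is a smooth strongly pseudoconvex handlebody with center $D\cup M$ inside $D\cup\{|x|<\epsilon\}$. Moreover $$ D\cup\{|x|\le\sigma\}\subset K\subset D\cup\{|x|<\epsilon\}.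 $$ -/

import Mathlib

open Set Filter Topology
open scoped ContDiff

namespace Handlebody

/-- Complex Euclidean space `ℂⁿ`. -/
abbrev Cn (n : ℕ) : Type := EuclideanSpace ℂ (Fin n)

/-- The vector `x` of `z = x + iy`. -/
def rePart {n : ℕ} (z : Cn n) : EuclideanSpace ℝ (Fin n) :=
  WithLp.toLp 2 (fun j => (z j).re)

/-- The vector `y` of `z = x + iy`. -/
def imPart {n : ℕ} (z : Cn n) : EuclideanSpace ℝ (Fin n) :=
  WithLp.toLp 2 (fun j => (z j).im)

/-! ### Strongly pseudoconvex domains -/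

/-- `∂F/∂z_j = (∂F/∂x_j - i ∂F/∂y_j) / 2`. -/
noncomputable def dz {n : ℕ} (j : Fin n) (F : Cn n → ℂ) (z : Cn n) : ℂ :=
  (fderiv ℝ F z (EuclideanSpace.single j 1)
    - Complex.I * fderiv ℝ F z (EuclideanSpace.single j Complex.I)) / 2

/-- `∂F/∂z̄_j = (∂F/∂x_j + i ∂F/∂y_j) / 2`. -/
noncomputable def dzbar {n : ℕ} (j : Fin n) (F : Cn n → ℂ) (z : Cn n) : ℂ :=
  (fderiv ℝ F z (EuclideanSpace.single j 1)
    + Complex.I * fderiv ℝ F z (EuclideanSpace.single j Complex.I)) / 2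

/-- The Levi form `∑_{j,k} ∂²ρ/∂z_j∂z̄_k (z) v_j v̄_k`. For a `C²` function the sum is a real
number; `re` only changes its type. -/
noncomputable def leviForm {n : ℕ} (ρ : Cn n → ℝ) (z v : Cn n) : ℝ :=
  (∑ j : Fin n, ∑ k : Fin n,
    dz j (dzbar k (fun w => (ρ w : ℂ))) z * v j * (starRingEnd ℂ) (v k)).re

/-- A smooth strongly plurisubharmonic function on `U`. -/
def IsSmoothStronglyPSHOn {n : ℕ} (ρ : Cn n → ℝ) (U : Set (Cn n)) : Prop :=
  ContDiffOn ℝ ∞ ρ U ∧ ∀ z ∈ U, ∀ v : Cn n, v ≠ 0 → 0 < leviForm ρ z v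

/-- A closed, smoothly bounded, strongly pseudoconvex domain `K` in `ℂⁿ`: `K = {ρ ≤ 0}`, where
`ρ` is a smooth strongly plurisubharmonic function in an open set `U ⊇ K`, and `dρ ≠ 0` on
`bK = {ρ = 0}`. -/
def IsStronglyPseudoconvexDomain {n : ℕ} (K : Set (Cn n)) : Prop :=
  IsClosed K ∧ ∃ (U : Set (Cn n)) (ρ : Cn n → ℝ),
    IsOpen U ∧ K ⊆ U ∧ IsSmoothStronglyPSHOn ρ U ∧
    K = {z ∈ U | ρ z ≤ 0} ∧ frontier K = {z ∈ U | ρ z = 0} ∧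
    ∀ z ∈ frontier K, fderiv ℝ ρ z ≠ 0

/-! ### Totally real handles -/

/-- In the open set `W`, the set `M` is a smooth submanifold of real codimension `m` with boundary
`B`, cut out by `r = 0`, `s ≤ 0` with `dr` of full rank along `M`, and `(dr, ds)` of full rank
along `B = {r = 0, s = 0}`.

Hence at `p ∈ M ∩ W` the tangent space `T_p M` is `ker dr_p`, and at `p ∈ B ∩ W` the tangent space
`T_p B` is `ker dr_p ∩ ker ds_p`. -/
structure IsLocalPresentation {n m : ℕ} (M B W : Set (Cn n))
    (r : Cn n → EuclideanSpace ℝ (Fin m)) (s : Cn n → ℝ) : Prop where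
  isOpen : IsOpen W
  smooth_r : ContDiffOn ℝ ∞ r W
  smooth_s : ContDiffOn ℝ ∞ s W
  eq_M : M ∩ W = {z ∈ W | r z = 0 ∧ s z ≤ 0}
  eq_B : B ∩ W = {z ∈ W | r z = 0 ∧ s z = 0}
  rank_M : ∀ z ∈ M ∩ W, Function.Surjective (fderiv ℝ r z)
  rank_B : ∀ z ∈ B ∩ W, Function.Surjective ((fderiv ℝ r z).prod (fderiv ℝ s z))

/-- In the open set `W`, the set `D` is `{ρ ≤ 0}` with `ρ` smooth and `dρ ≠ 0` on `{ρ = 0}`.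
Hence `T_p(bD) = ker dρ_p` for `p ∈ bD ∩ W`. -/
structure IsLocalDefiningFunction {n : ℕ} (D W : Set (Cn n)) (ρ : Cn n → ℝ) : Prop where
  isOpen : IsOpen W
  smooth : ContDiffOn ℝ ∞ ρ W
  eq_D : D ∩ W = {z ∈ W | ρ z ≤ 0}
  ne_zero : ∀ z ∈ W, ρ z = 0 → fderiv ℝ ρ z ≠ 0

/-- `M` is a totally real handle attached to `D` along the Legendrian submanifold `S`:
`M` is a smooth submanifold with boundary `B`, `S` is a union of connected components of `B`,
`M ∩ D = S ⊆ bD`, `T_p M ∩ J T_p M = 0` for `p ∈ M`, and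
`T_p S ⊆ T_p(bD) ∩ J T_p(bD)` for `p ∈ S`. The complex structure `J` is multiplication by `i`;
a vector `v` lies in `T ∩ J T` exactly when `v` and `i v` lie in `T`. -/
def IsTotallyRealHandle {n : ℕ} (D M S : Set (Cn n)) : Prop :=
  ∃ (m : ℕ) (B : Set (Cn n)),
    B ⊆ M ∧ S ⊆ B ∧ (∀ p ∈ S, connectedComponentIn B p ⊆ S) ∧
    M ∩ D = S ∧ S ⊆ frontier D ∧
    ∀ p ∈ M, ∃ (W : Set (Cn n)) (r : Cn n → EuclideanSpace ℝ (Fin m)) (s : Cn n → ℝ),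
      p ∈ W ∧ IsLocalPresentation M B W r s ∧
      (∀ v : Cn n, fderiv ℝ r p v = 0 → fderiv ℝ r p (Complex.I • v) = 0 → v = 0) ∧
      (p ∈ S → ∃ (V : Set (Cn n)) (ρ : Cn n → ℝ), p ∈ V ∧ IsLocalDefiningFunction D V ρ ∧
        ∀ v : Cn n, fderiv ℝ r p v = 0 → fderiv ℝ s p v = 0 →
          fderiv ℝ ρ p v = 0 ∧ fderiv ℝ ρ p (Complex.I • v) = 0)

/-! ### Handlebodies -/

/-- `K` admits a strong deformation retraction onto its subset `E`. -/
def StronglyDeformationRetractsOnto {X : Type*} [TopologicalSpace X] (K E : Set X) : Prop :=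
  E ⊆ K ∧ ∃ H : ℝ × X → X, ContinuousOn H (Icc (0 : ℝ) 1 ×ˢ K) ∧
    (∀ t ∈ Icc (0 : ℝ) 1, ∀ z ∈ K, H (t, z) ∈ K) ∧
    (∀ z ∈ K, H (0, z) = z) ∧
    (∀ z ∈ K, H (1, z) ∈ E) ∧
    (∀ t ∈ Icc (0 : ℝ) 1, ∀ z ∈ E, H (t, z) = z)

/-- `K` is a smooth strongly pseudoconvex handlebody with center `D ∪ M` inside `D ∪ U`, where `U`
is an open neighborhood of the totally real handle `M` attached to the strongly pseudoconvex
domain `D`. -/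
structure IsStronglyPseudoconvexHandlebody {n : ℕ} (D M U K : Set (Cn n)) : Prop where
  domain_D : IsStronglyPseudoconvexDomain D
  handle_M : ∃ S : Set (Cn n), IsTotallyRealHandle D M S
  isOpen_U : IsOpen U
  M_subset_U : M ⊆ U
  domain_K : IsStronglyPseudoconvexDomain K
  center_subset : D ∪ M ⊆ K
  subset_nhd : K ⊆ D ∪ U
  retract : StronglyDeformationRetractsOnto K (D ∪ M)

/-! ### The profile functions -/

/-- `g(t) = √(λ t² + a)`. -/
noncomputable def g (lam a t : ℝ) : ℝ := Real.sqrt (lam * t ^ 2 + a)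

/-- The inverse of `f : [σ, ∞) → [f(σ), ∞)`, extended by `σ` to `u ≤ f(σ)`. -/
noncomputable def extInv (σ : ℝ) (f : ℝ → ℝ) (u : ℝ) : ℝ :=
  open Classical in if u ≤ f σ then σ else Function.invFunOn f (Ici σ) u

/-- The properties of a profile function `f : [σ, ∞) → [f(σ), ∞)` (values of `f` outside `[σ, ∞)`
play no role). At `u = 0` the inequalities for the inverse function, which is constant near `0`,
are void. -/
structure IsProfile (lam a ε σ : ℝ) (f : ℝ → ℝ) : Prop where
  sigma_pos : 0 < σ
  sigma_lt : σ < ε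
  continuousOn : ContinuousOn f (Ici σ)
  pos : ∀ t ∈ Ici σ, 0 < f t
  strictMonoOn : StrictMonoOn f (Ici σ)
  smooth : ContDiffOn ℝ ∞ f (Ioi σ)
  ineq_second : ∀ t ∈ Ioi σ, 1 < f t * (deriv (deriv f) t + deriv f t ^ 3 / t)
  ineq_first : ∀ t ∈ Ioi σ, 1 < f t * deriv f t / t
  eq_g : ∀ t, ε ≤ t → f t = g lam a t
  lt_g : ∀ t, σ ≤ t → t < ε → f t < g lam a t
  deriv_tendsto : Tendsto (deriv f) (𝓝[>] σ) atTop
  inv_smooth : ContDiffOn ℝ ∞ (extInv σ f) (Ici 0)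
  inv_ineq_second : ∀ u ∈ Ioi (0 : ℝ),
    extInv σ f u * (deriv (deriv (extInv σ f)) u + deriv (extInv σ f) u ^ 3 / u) < 1
  inv_ineq_first : ∀ u ∈ Ioi (0 : ℝ), extInv σ f u * deriv (extInv σ f) u / u < 1

/-! ### The sets -/

/-- `D = {x + iy : |y|² ≥ λ|x|² + a}`. -/
def setD (n : ℕ) (lam a : ℝ) : Set (Cn n) :=
  {z | lam * ‖rePart z‖ ^ 2 + a ≤ ‖imPart z‖ ^ 2}

/-- `M = {iy : |y| ≤ √a}`. -/
def setM (n : ℕ) (a : ℝ) : Set (Cn n) :=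
  {z | rePart z = 0 ∧ ‖imPart z‖ ≤ Real.sqrt a}

/-- `K = {x + iy : |x| ≤ f⁻¹(|y|)}`. -/
def setK (n : ℕ) (σ : ℝ) (f : ℝ → ℝ) : Set (Cn n) :=
  {z | ‖rePart z‖ ≤ extInv σ f ‖imPart z‖}

end Handlebody

/-!
Put `h = f⁻¹` and `φ(s) = h(√s)²`, which is smooth on all of `ℝ` because `h` is constant near `0`.
Then `K = {|x|² ≤ φ(|y|²)}`, and likewise `D` is such a tube, with the affine function
`φ(s) = (s - a) / λ`. As `x` and `y` are separated in `ρ = |x|² - φ(|y|²)`, the Levi form of `ρ` at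
`v` is a multiple of
`(1 - φ') |v|² - 2 φ'' |⟨y, v⟩|²`, evaluated at `s = |y|²`.

For `D` this is `(1 - 1/λ) |v|² > 0`. For `K` it is positive on the kernel of `∂ρ`, at every point
of `K` and not just on its boundary: the two hypotheses on `h` read `φ' < 1` and
`2 s φ'' < (1 - φ') (1 + s φ'² / φ)`, and on that kernel a Bessel-type inequality
(`bessel_tangent`) bounds `|v|²` from below by `|⟨y, v⟩|² (1 / s + φ'² / φ)`. Hence the
convexification `exp (C ρ) - 1` is strongly plurisubharmonic along `K` for a large constant `C`
(`exists_leviQuad_pos`). One constant suffices although `K` is not compact, because `φ` is affine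
with slope `1/λ < 1` for large `s`.

The Levi form, defined by Wirtinger derivatives, is computed as a quarter of the sum of the second
real derivatives in the directions `v` and `i v` (`leviForm_eq`).

The center `D ∪ M` consists of the balls `|x| ≤ √(max (|y|² - a) 0 / λ)` over the points `y`, so
that `K`, a union of larger balls, retracts onto it by shrinking `x` with `y` fixed.
-/

namespace Handlebody

/-! ### Real coordinates -/

/-- `rePart` as a continuous real-linear map. -/
noncomputable def reL (n : ℕ) : Cn n →L[ℝ] EuclideanSpace ℝ (Fin n) :=
  LinearMap.toContinuousLinearMap
    { toFun := rePart
      map_add' := fun z w => by ext j; simp [rePart]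
      map_smul' := fun c z => by ext j; simp [rePart] }

/-- `imPart` as a continuous real-linear map. -/
noncomputable def imL (n : ℕ) : Cn n →L[ℝ] EuclideanSpace ℝ (Fin n) :=
  LinearMap.toContinuousLinearMap
    { toFun := imPart
      map_add' := fun z w => by ext j; simp [imPart]
      map_smul' := fun c z => by ext j; simp [imPart] }

/-- The inclusion `ℝⁿ ⊆ ℂⁿ`. -/
noncomputable def ofRealL (n : ℕ) : EuclideanSpace ℝ (Fin n) →L[ℝ] Cn n :=
  LinearMap.toContinuousLinearMap
    { toFun := fun x => WithLp.toLp 2 (fun j => (x j : ℂ))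
      map_add' := fun z w => by ext j; simp
      map_smul' := fun c z => by ext j; simp }

variable {n : ℕ}

@[simp] lemma reL_apply (z : Cn n) : reL n z = rePart z := rfl

@[simp] lemma imL_apply (z : Cn n) : imL n z = imPart z := rfl

lemma continuous_rePart : Continuous (rePart : Cn n → _) := (reL n).continuous

lemma continuous_imPart : Continuous (imPart : Cn n → _) := (imL n).continuous

@[simp] lemma rePart_ofRealL (x : EuclideanSpace ℝ (Fin n)) : rePart (ofRealL n x) = x := by
  ext j; simp [rePart, ofRealL]

@[simp] lemma imPart_ofRealL (x : EuclideanSpace ℝ (Fin n)) : imPart (ofRealL n x) = 0 := by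
  ext j; simp [imPart, ofRealL]

lemma rePart_I_smul (z : Cn n) : rePart (Complex.I • z) = -imPart z := by
  ext j; simp [rePart, imPart]

lemma imPart_I_smul (z : Cn n) : imPart (Complex.I • z) = rePart z := by
  ext j; simp [rePart, imPart]

lemma norm_sq_eq_re_add_im (z : Cn n) : ‖z‖ ^ 2 = ‖rePart z‖ ^ 2 + ‖imPart z‖ ^ 2 := by
  rw [EuclideanSpace.norm_sq_eq, EuclideanSpace.norm_sq_eq, EuclideanSpace.norm_sq_eq,
    ← Finset.sum_add_distrib]
  refine Finset.sum_congr rfl fun j _ => ?_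
  simp only [rePart, imPart, Real.norm_eq_abs, sq_abs, Complex.sq_norm, Complex.normSq_apply]
  ring

lemma ext_re_im {z w : Cn n} (h₁ : rePart z = rePart w) (h₂ : imPart z = imPart w) : z = w := by
  ext j
  exact Complex.ext (congrArg (fun x => x j) h₁) (congrArg (fun x => x j) h₂)

/-! ### The Levi form in terms of real second derivatives -/

/-- A vector of `ℂⁿ` in the real basis `e_j, i e_j`. -/
lemma eq_sum_single (v : Cn n) :
    v = ∑ j, ((v j).re • EuclideanSpace.single j (1 : ℂ) +
      (v j).im • EuclideanSpace.single j Complex.I) := by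
  ext j
  simp only [WithLp.ofLp_sum, WithLp.ofLp_add, WithLp.ofLp_smul, Finset.sum_apply,
    Pi.add_apply, Pi.smul_apply, PiLp.single_apply, Complex.real_smul]
  rw [Finset.sum_eq_single j]
  · simp [Complex.re_add_im]
  · intro b _ hb
    simp [hb.symm]
  · simp

lemma fderiv_ofReal {ρ : Cn n → ℝ} {z : Cn n} (h : DifferentiableAt ℝ ρ z) (v : Cn n) :
    fderiv ℝ (fun w => (ρ w : ℂ)) z v = (fderiv ℝ ρ z v : ℂ) := by
  have := (Complex.ofRealCLM.hasFDerivAt (x := ρ z)).comp z h.hasFDerivAt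
  have h2 : fderiv ℝ (fun w => (ρ w : ℂ)) z = Complex.ofRealCLM.comp (fderiv ℝ ρ z) :=
    this.fderiv
  rw [h2]; rfl

lemma hasFDerivAt_fderiv_apply {ρ : Cn n → ℝ} (hρ : ContDiff ℝ 2 ρ) (z e : Cn n) :
    HasFDerivAt (fun w => fderiv ℝ ρ w e) ((fderiv ℝ (fderiv ℝ ρ) z).flip e) z := by
  have hd : HasFDerivAt (fderiv ℝ ρ) (fderiv ℝ (fderiv ℝ ρ) z) z :=
    ((hρ.fderiv_right (m := 1) (by norm_num)).differentiable (by norm_num) z).hasFDerivAt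
  simpa using hd.clm_apply (hasFDerivAt_const e z)

/-- The Levi form of `ρ` in the direction `v` is a quarter of the Laplacian of `ρ` on the complex
line spanned by `v`. -/
lemma leviForm_eq {ρ : Cn n → ℝ} (hρ : ContDiff ℝ 2 ρ) (z v : Cn n) :
    leviForm ρ z v = (fderiv ℝ (fderiv ℝ ρ) z v v +
      fderiv ℝ (fderiv ℝ ρ) z (Complex.I • v) (Complex.I • v)) / 4 := by
  set D := fderiv ℝ (fderiv ℝ ρ) z with hD
  have hd : Differentiable ℝ ρ := hρ.differentiable (by norm_num)
  have key : ∀ j k : Fin n, dz j (dzbar k (fun w => (ρ w : ℂ))) z =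
      (((D (EuclideanSpace.single j 1) (EuclideanSpace.single k 1)
        + D (EuclideanSpace.single j Complex.I) (EuclideanSpace.single k Complex.I) : ℝ) : ℂ)
      + Complex.I * ((D (EuclideanSpace.single j 1) (EuclideanSpace.single k Complex.I)
        - D (EuclideanSpace.single j Complex.I) (EuclideanSpace.single k 1) : ℝ) : ℂ)) / 4 := by
    intro j k
    have h1 : dzbar k (fun w => (ρ w : ℂ)) = fun w =>
        ((fderiv ℝ ρ w (EuclideanSpace.single k 1) : ℂ)
          + Complex.I * (fderiv ℝ ρ w (EuclideanSpace.single k Complex.I) : ℂ)) / 2 := by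
      funext w
      simp only [dzbar, fderiv_ofReal (hd w)]
    have hc : ∀ e : Cn n, HasFDerivAt (fun w => ((fderiv ℝ ρ w e : ℝ) : ℂ))
        (Complex.ofRealCLM.comp (D.flip e)) z := fun e =>
      (Complex.ofRealCLM.hasFDerivAt (x := fderiv ℝ ρ z e)).comp z
        (hasFDerivAt_fderiv_apply hρ z e)
    have h3 := ((hc (EuclideanSpace.single k 1)).add
      ((hc (EuclideanSpace.single k Complex.I)).const_mul Complex.I)).mul_const ((2 : ℂ)⁻¹)
    have h4 : fderiv ℝ (dzbar k (fun w => (ρ w : ℂ))) z = (2 : ℂ)⁻¹ •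
        (Complex.ofRealCLM.comp (D.flip (EuclideanSpace.single k 1)) +
          Complex.I • Complex.ofRealCLM.comp (D.flip (EuclideanSpace.single k Complex.I))) := by
      rw [h1]
      simp only [div_eq_mul_inv]
      exact h3.fderiv
    simp only [dz, h4]
    simp
    linear_combination (-(1 : ℂ) / 4 * D (EuclideanSpace.single j Complex.I)
      (EuclideanSpace.single k Complex.I)) * Complex.I_sq
  have hv := eq_sum_single v
  have hIv : Complex.I • v = ∑ j, ((-(v j).im) • EuclideanSpace.single j (1 : ℂ) +
      (v j).re • EuclideanSpace.single j Complex.I) := by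
    have := eq_sum_single (Complex.I • v)
    simpa using this
  have bil : ∀ u : Fin n → Cn n, D (∑ j, u j) (∑ k, u k) = ∑ j, ∑ k, D (u j) (u k) := fun u => by
    simp only [map_sum, sum_apply]
    exact Finset.sum_comm
  have e1 : D v v = ∑ j, ∑ k, D ((v j).re • EuclideanSpace.single j (1 : ℂ) +
      (v j).im • EuclideanSpace.single j Complex.I) ((v k).re • EuclideanSpace.single k (1 : ℂ) +
      (v k).im • EuclideanSpace.single k Complex.I) := by
    conv_lhs => rw [hv]
    exact bil _
  have e2 : D (Complex.I • v) (Complex.I • v) =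
      ∑ j, ∑ k, D ((-(v j).im) • EuclideanSpace.single j (1 : ℂ) +
      (v j).re • EuclideanSpace.single j Complex.I) ((-(v k).im) • EuclideanSpace.single k (1 : ℂ) +
      (v k).re • EuclideanSpace.single k Complex.I) := by
    rw [hIv]
    exact bil _
  rw [leviForm, e1, e2, Complex.re_sum, ← Finset.sum_add_distrib, Finset.sum_div]
  refine Finset.sum_congr rfl fun j _ => ?_
  rw [Complex.re_sum, ← Finset.sum_add_distrib, Finset.sum_div]
  refine Finset.sum_congr rfl fun k _ => ?_
  rw [key]
  simp only [map_add, map_smul, add_apply, smul_apply,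
    smul_eq_mul]
  generalize D (EuclideanSpace.single j 1) (EuclideanSpace.single k 1) = d11
  generalize D (EuclideanSpace.single j Complex.I) (EuclideanSpace.single k 1) = d21
  generalize D (EuclideanSpace.single j 1) (EuclideanSpace.single k Complex.I) = d12
  generalize D (EuclideanSpace.single j Complex.I) (EuclideanSpace.single k Complex.I) = d22
  have h4 : ∀ w : ℂ, w / 4 = ((1 / 4 : ℝ) : ℂ) * w := fun w => by push_cast; ring
  rw [h4]
  simp only [Complex.mul_re, Complex.mul_im, Complex.add_re, Complex.add_im, Complex.ofReal_re,
    Complex.ofReal_im, Complex.I_re, Complex.I_im, Complex.conj_re, Complex.conj_im]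
  ring

/-- The second derivative in the direction `v`, computed along the line `z + t v`. -/
lemma fderiv_fderiv_apply_eq {ρ : Cn n → ℝ} (hρ : ContDiff ℝ 2 ρ) {z v : Cn n} {p : ℝ → ℝ}
    {c : ℝ} (hp : ∀ t, HasDerivAt (fun t : ℝ => ρ (z + t • v)) (p t) t) (hc : HasDerivAt p c 0) :
    fderiv ℝ (fderiv ℝ ρ) z v v = c := by
  have hd : Differentiable ℝ ρ := hρ.differentiable (by norm_num)
  have hline : ∀ t : ℝ, HasDerivAt (fun t : ℝ => z + t • v) v t := fun t => by
    simpa using ((hasDerivAt_id t).smul_const v).const_add z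
  have h1 : p = fun t => fderiv ℝ ρ (z + t • v) v := by
    funext t
    exact (hp t).unique ((hd (z + t • v)).hasFDerivAt.comp_hasDerivAt t (hline t))
  have h0 : z + (0 : ℝ) • v = z := by simp
  have h2 : HasDerivAt (fun t : ℝ => fderiv ℝ ρ (z + t • v) v)
      ((fderiv ℝ (fderiv ℝ ρ) z).flip v v) 0 := by
    have h3 : HasFDerivAt (fun w => fderiv ℝ ρ w v) ((fderiv ℝ (fderiv ℝ ρ) z).flip v)
        (z + (0 : ℝ) • v) := by
      rw [h0]
      exact hasFDerivAt_fderiv_apply hρ z v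
    exact h3.comp_hasDerivAt 0 (hline 0)
  rw [h1] at hc
  exact h2.unique hc

/-! ### Tube functions -/

/-- The function `|x|² - φ(|y|²)`. -/
noncomputable def tubeFun (φ : ℝ → ℝ) (z : Cn n) : ℝ := ‖rePart z‖ ^ 2 - φ (‖imPart z‖ ^ 2)

/-- The convexified function `exp (C (|x|² - φ(|y|²))) - 1`, with the same sublevel set `{≤ 0}`
as `tubeFun φ` when `0 < C`. -/
noncomputable def expTube (C : ℝ) (φ : ℝ → ℝ) (z : Cn n) : ℝ := Real.exp (C * tubeFun φ z) - 1

lemma contDiff_tubeFun {φ : ℝ → ℝ} (hφ : ContDiff ℝ ∞ φ) :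
    ContDiff ℝ ∞ (tubeFun φ : Cn n → ℝ) :=
  ((reL n).contDiff.norm_sq ℝ).sub (hφ.comp ((imL n).contDiff.norm_sq ℝ))

lemma contDiff_expTube {φ : ℝ → ℝ} (hφ : ContDiff ℝ ∞ φ) (C : ℝ) :
    ContDiff ℝ ∞ (expTube C φ : Cn n → ℝ) :=
  (contDiff_const.mul (contDiff_tubeFun hφ)).exp.sub contDiff_const

lemma hasFDerivAt_tubeFun {φ : ℝ → ℝ} (hφ : ContDiff ℝ ∞ φ) (z : Cn n) :
    HasFDerivAt (tubeFun φ)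
      (2 • (innerSL ℝ (rePart z)).comp (reL n) -
        deriv φ (‖imPart z‖ ^ 2) • (2 • (innerSL ℝ (imPart z)).comp (imL n))) z := by
  have h1 := ((reL n).hasFDerivAt (x := z)).norm_sq
  have h2 := ((imL n).hasFDerivAt (x := z)).norm_sq
  exact h1.sub ((hφ.differentiable (by simp) (‖imPart z‖ ^ 2)).hasDerivAt.comp_hasFDerivAt z h2)

lemma fderiv_tubeFun {φ : ℝ → ℝ} (hφ : ContDiff ℝ ∞ φ) (z v : Cn n) :
    fderiv ℝ (tubeFun φ) z v = 2 * inner ℝ (rePart z) (rePart v) -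
      2 * deriv φ (‖imPart z‖ ^ 2) * inner ℝ (imPart z) (imPart v) := by
  rw [(hasFDerivAt_tubeFun hφ z).fderiv]
  simp
  ring

lemma fderiv_expTube {φ : ℝ → ℝ} (hφ : ContDiff ℝ ∞ φ) (C : ℝ) (z v : Cn n) :
    fderiv ℝ (expTube C φ) z v =
      Real.exp (C * tubeFun φ z) * (C * fderiv ℝ (tubeFun φ) z v) := by
  have h1 : HasFDerivAt (expTube C φ) _ z :=
    (((hasFDerivAt_tubeFun hφ z).const_mul C).exp).sub_const 1
  rw [h1.fderiv, (hasFDerivAt_tubeFun hφ z).fderiv]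
  simp

lemma fderiv_fderiv_expTube {φ : ℝ → ℝ} (hφ : ContDiff ℝ ∞ φ) (C : ℝ) (z v : Cn n) :
    fderiv ℝ (fderiv ℝ (expTube C φ)) z v v = C * Real.exp (C * tubeFun φ z) *
      (2 * ‖rePart v‖ ^ 2 - 2 * deriv φ (‖imPart z‖ ^ 2) * ‖imPart v‖ ^ 2
        - 4 * deriv (deriv φ) (‖imPart z‖ ^ 2) * inner ℝ (imPart z) (imPart v) ^ 2
        + C * (2 * inner ℝ (rePart z) (rePart v) -
          2 * deriv φ (‖imPart z‖ ^ 2) * inner ℝ (imPart z) (imPart v)) ^ 2) := by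
  set X := ‖rePart z‖ ^ 2 with hX
  set S := ‖imPart z‖ ^ 2 with hS
  set α := inner ℝ (rePart z) (rePart v) with hα
  set γ := inner ℝ (imPart z) (imPart v) with hγ
  set β := ‖rePart v‖ ^ 2 with hβ
  set δ := ‖imPart v‖ ^ 2 with hδ
  have hquad : ∀ a b c t : ℝ,
      HasDerivAt (fun t : ℝ => a + 2 * t * b + t ^ 2 * c) (2 * b + 2 * t * c) t := fun a b c t => by
    have h := ((((hasDerivAt_id t).const_mul 2).mul_const b).const_add a).add
      (((hasDerivAt_id t).pow 2).mul_const c)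
    exact h.congr_deriv (by simp)
  have hlin : ∀ b c t : ℝ, HasDerivAt (fun t : ℝ => 2 * b + 2 * t * c) (2 * c) t := fun b c t => by
    have h := (((hasDerivAt_id t).const_mul 2).mul_const c).const_add (2 * b)
    simpa using h
  have hφ1 : ∀ s, HasDerivAt φ (deriv φ s) s := fun s =>
    (hφ.differentiable (by simp) s).hasDerivAt
  have hφ2 : ∀ s, HasDerivAt (deriv φ) (deriv (deriv φ) s) s := fun s =>
    ((contDiff_infty_iff_deriv.1 hφ).2.differentiable (by simp) s).hasDerivAt
  set τ : ℝ → ℝ := fun t => X + 2 * t * α + t ^ 2 * β - φ (S + 2 * t * γ + t ^ 2 * δ) with hτdef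
  have hτ : ∀ t : ℝ, tubeFun φ (z + t • v) = τ t := fun t => by
    have e1 : rePart (z + t • v) = rePart z + t • rePart v := by
      simpa using map_add (reL n) z (t • v)
    have e2 : imPart (z + t • v) = imPart z + t • imPart v := by
      simpa using map_add (imL n) z (t • v)
    simp only [tubeFun, hτdef, e1, e2, norm_add_sq_real, inner_smul_right, norm_smul, mul_pow,
      Real.norm_eq_abs, sq_abs, hX, hS, hα, hγ, hβ, hδ, mul_assoc]
  set τ' : ℝ → ℝ := fun t => 2 * α + 2 * t * β -
    deriv φ (S + 2 * t * γ + t ^ 2 * δ) * (2 * γ + 2 * t * δ) with hτ'def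
  have hdτ : ∀ t, HasDerivAt τ (τ' t) t := fun t =>
    (hquad X α β t).sub ((hφ1 _).comp t (hquad S γ δ t))
  have hdτ' : HasDerivAt τ' (2 * β - (deriv (deriv φ) S * (2 * γ) * (2 * γ)
      + deriv φ S * (2 * δ))) 0 := by
    have h2 : HasDerivAt (fun t : ℝ => deriv φ (S + 2 * t * γ + t ^ 2 * δ))
        (deriv (deriv φ) (S + 2 * 0 * γ + 0 ^ 2 * δ) * (2 * γ + 2 * 0 * δ)) 0 :=
      (hφ2 _).comp (0 : ℝ) (hquad S γ δ 0)
    have h := (hlin α β 0).sub (h2.mul (hlin γ δ 0))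
    exact h.congr_deriv (by simp)
  have hexp : ∀ t, HasDerivAt (fun t => Real.exp (C * τ t))
      (Real.exp (C * τ t) * (C * τ' t)) t := fun t => ((hdτ t).const_mul C).exp
  have hsec := (hexp 0).mul (hdτ'.const_mul C)
  have hτ0 : τ 0 = tubeFun φ z := by simp [hτdef, tubeFun, hX, hS]
  have hτ'0 : τ' 0 = 2 * α - deriv φ S * (2 * γ) := by simp [hτ'def]
  rw [fderiv_fderiv_apply_eq ((contDiff_expTube hφ C).of_le (ENat.LEInfty.out))
    (p := fun t => Real.exp (C * τ t) * (C * τ' t)) ?_ hsec, hτ0, hτ'0]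
  · ring
  · intro t
    have h : (fun t : ℝ => expTube C φ (z + t • v)) = fun t => Real.exp (C * τ t) - 1 := by
      funext t
      rw [expTube, hτ]
    rw [h]
    exact (hexp t).sub_const 1

/-- Up to a positive factor, the Levi form of `expTube C φ` at `z` in the direction `v`. -/
noncomputable def leviQuad (C : ℝ) (φ : ℝ → ℝ) (z v : Cn n) : ℝ :=
  2 * (1 - deriv φ (‖imPart z‖ ^ 2)) * ‖v‖ ^ 2
    - 4 * deriv (deriv φ) (‖imPart z‖ ^ 2) *
      (inner ℝ (imPart z) (rePart v) ^ 2 + inner ℝ (imPart z) (imPart v) ^ 2)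
    + C * ((2 * inner ℝ (rePart z) (rePart v) -
          2 * deriv φ (‖imPart z‖ ^ 2) * inner ℝ (imPart z) (imPart v)) ^ 2
        + (2 * inner ℝ (rePart z) (imPart v) +
          2 * deriv φ (‖imPart z‖ ^ 2) * inner ℝ (imPart z) (rePart v)) ^ 2)

lemma leviForm_expTube {φ : ℝ → ℝ} (hφ : ContDiff ℝ ∞ φ) (C : ℝ) (z v : Cn n) :
    leviForm (expTube C φ) z v = C * Real.exp (C * tubeFun φ z) / 4 * leviQuad C φ z v := by
  rw [leviForm_eq ((contDiff_expTube hφ C).of_le (ENat.LEInfty.out)),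
    fderiv_fderiv_expTube hφ, fderiv_fderiv_expTube hφ, leviQuad, rePart_I_smul, imPart_I_smul,
    norm_sq_eq_re_add_im v, norm_neg, inner_neg_right]
  ring

lemma continuous_leviQuad {φ : ℝ → ℝ} (hφ : ContDiff ℝ ∞ φ) (C : ℝ) :
    Continuous fun q : Cn n × Cn n => leviQuad C φ q.1 q.2 := by
  have h1 : Continuous (deriv φ) := hφ.continuous_deriv (by simp)
  have h2 : Continuous (deriv (deriv φ)) :=
    (contDiff_infty_iff_deriv.1 hφ).2.continuous_deriv (by simp)
  have hr := continuous_rePart (n := n)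
  have hi := continuous_imPart (n := n)
  unfold leviQuad
  fun_prop

lemma leviQuad_smul (C : ℝ) (φ : ℝ → ℝ) (z v : Cn n) (c : ℝ) :
    leviQuad C φ z (c • v) = c ^ 2 * leviQuad C φ z v := by
  have e1 : rePart (c • v) = c • rePart v := map_smul (reL n) c v
  have e2 : imPart (c • v) = c • imPart v := map_smul (imL n) c v
  simp only [leviQuad, e1, e2, inner_smul_right, norm_smul, mul_pow, Real.norm_eq_abs, sq_abs]
  ring

lemma leviQuad_pos_of_sphere {C : ℝ} {φ : ℝ → ℝ} {z : Cn n}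
    (h : ∀ v ∈ Metric.sphere (0 : Cn n) 1, 0 < leviQuad C φ z v) {v : Cn n} (hv : v ≠ 0) :
    0 < leviQuad C φ z v := by
  have hn : 0 < ‖v‖ := norm_pos_iff.2 hv
  have h1 := h (‖v‖⁻¹ • v) (by simp [norm_smul, hn.ne'])
  rw [leviQuad_smul] at h1
  exact (mul_pos_iff_of_pos_left (by positivity)).1 h1

/-- A point where a function vanishes with nonzero derivative lies on the boundary of its
sublevel set. -/
lemma frontier_sublevel_eq {E : Type*} [NormedAddCommGroup E] [NormedSpace ℝ E] {ρ : E → ℝ}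
    (hc : Continuous ρ) (hd : ∀ z, ρ z = 0 → fderiv ℝ ρ z ≠ 0) :
    frontier {z | ρ z ≤ 0} = {z | ρ z = 0} := by
  refine (frontier_le_subset_eq hc continuous_const).antisymm fun z hz => ?_
  refine ⟨subset_closure (le_of_eq hz), fun hint => hd z hz ?_⟩
  refine IsLocalMax.fderiv_eq_zero ?_
  filter_upwards [mem_interior_iff_mem_nhds.1 hint] with w hw
  exact hw.trans_eq (Eq.symm hz)

/-- The condition `hpos` is required only on the tube: it persists on a neighborhood. -/
lemma isStronglyPseudoconvexDomain_tube {φ : ℝ → ℝ} (hφ : ContDiff ℝ ∞ φ) {C : ℝ} (hC : 0 < C)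
    (hd : ∀ z : Cn n, tubeFun φ z = 0 → fderiv ℝ (tubeFun φ) z ≠ 0)
    (hpos : ∀ z : Cn n, tubeFun φ z ≤ 0 → ∀ v ∈ Metric.sphere (0 : Cn n) 1,
      0 < leviQuad C φ z v) :
    IsStronglyPseudoconvexDomain {z : Cn n | tubeFun φ z ≤ 0} := by
  have hle : ∀ z : Cn n, expTube C φ z ≤ 0 ↔ tubeFun φ z ≤ 0 := fun z => by
    rw [expTube, sub_nonpos, Real.exp_le_one_iff]
    simpa using mul_le_mul_iff_right₀ hC (b := tubeFun φ z) (c := 0)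
  have heq : ∀ z : Cn n, expTube C φ z = 0 ↔ tubeFun φ z = 0 := fun z => by
    rw [expTube, sub_eq_zero, Real.exp_eq_one_iff, mul_eq_zero, or_iff_right hC.ne']
  have hfr := frontier_sublevel_eq (contDiff_tubeFun hφ).continuous hd
  have hKU : {z : Cn n | tubeFun φ z ≤ 0} ⊆
      {z | ∀ v ∈ Metric.sphere (0 : Cn n) 1, 0 < leviQuad C φ z v} := fun z hz => hpos z hz
  refine ⟨isClosed_le (contDiff_tubeFun hφ).continuous continuous_const,
    {z | ∀ v ∈ Metric.sphere (0 : Cn n) 1, 0 < leviQuad C φ z v}, expTube C φ, ?_, hKU,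
    ⟨(contDiff_expTube hφ C).contDiffOn, fun z hz v hv => ?_⟩, ?_, ?_, ?_⟩
  · -- positivity on the compact unit sphere is an open condition
    rw [isOpen_iff_mem_nhds]
    intro z hz
    refine (isCompact_sphere (0 : Cn n) 1).eventually_forall_of_forall_eventually fun v hv => ?_
    exact continuous_const.continuousAt.eventually_lt
      (continuous_leviQuad hφ C).continuousAt (hz v hv)
  · rw [leviForm_expTube hφ]
    have := leviQuad_pos_of_sphere hz hv
    positivity
  · ext z
    exact ⟨fun h => ⟨hKU h, (hle z).2 h⟩, fun h => (hle z).1 h.2⟩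
  · rw [hfr]
    ext z
    exact ⟨fun h => ⟨hKU (le_of_eq h), (heq z).2 h⟩, fun h => (heq z).1 h.2⟩
  · rw [hfr]
    intro z hz h0
    refine hd z hz (ContinuousLinearMap.ext fun v => ?_)
    have h1 := fderiv_expTube hφ C z v
    rw [h0] at h1
    simpa [hC.ne', (Real.exp_pos _).ne'] using h1.symm

/-! ### Positivity on the complex tangent directions -/

/-- On the kernel of `∂(|x|² - φ(|y|²))`, the bound `|v|² ≥ |c|² (1 / |y|² + φ'² / φ)`, where
`c = ⟨y, v⟩`, follows from `|v - w|² ≥ 0` for `w = c (y / |y|² - i φ' x / φ)`: the cross term of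
`|w|²` vanishes, since `x` and `y` are real. -/
lemma bessel_tangent {E : Type*} [NormedAddCommGroup E] [InnerProductSpace ℝ E]
    {x y ξ η : E} {P Φ : ℝ} (hy : y ≠ 0) (hΦ : 0 < Φ) (hx : ‖x‖ ^ 2 ≤ Φ)
    (h1 : inner ℝ x ξ = P * inner ℝ y η) (h2 : inner ℝ x η = -(P * inner ℝ y ξ)) :
    (inner ℝ y ξ ^ 2 + inner ℝ y η ^ 2) * (1 / ‖y‖ ^ 2 + P ^ 2 / Φ) ≤ ‖ξ‖ ^ 2 + ‖η‖ ^ 2 := by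
  have hs : 0 < ‖y‖ ^ 2 := by positivity
  set s := ‖y‖ ^ 2 with hsdef
  set a := inner ℝ y ξ with ha
  set b := inner ℝ y η with hb
  set d := inner ℝ x y with hd
  have g1 : ‖ξ - ((a / s) • y + (P * b / Φ) • x)‖ ^ 2 = ‖ξ‖ ^ 2 - 2 * (a * a / s + P * b / Φ * (P * b))
      + (a ^ 2 / s + 2 * (a / s) * (P * b / Φ) * d + (P * b / Φ) ^ 2 * ‖x‖ ^ 2) := by
    rw [norm_sub_sq_real, norm_add_sq_real, inner_add_right, inner_smul_right, inner_smul_right,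
      inner_smul_left, inner_smul_right, real_inner_comm y ξ, real_inner_comm x ξ, h1, ← ha,
      norm_smul, norm_smul, mul_pow, mul_pow, ← hsdef, real_inner_comm x y, ← hd]
    simp only [Real.norm_eq_abs, sq_abs, conj_trivial]
    field_simp
  have g2 : ‖η - ((b / s) • y - (P * a / Φ) • x)‖ ^ 2 = ‖η‖ ^ 2 - 2 * (b * b / s + P * a / Φ * (P * a))
      + (b ^ 2 / s - 2 * (b / s) * (P * a / Φ) * d + (P * a / Φ) ^ 2 * ‖x‖ ^ 2) := by
    rw [norm_sub_sq_real, norm_sub_sq_real, inner_sub_right, inner_smul_right, inner_smul_right,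
      inner_smul_left, inner_smul_right, real_inner_comm y η, real_inner_comm x η, h2, ← hb,
      norm_smul, norm_smul, mul_pow, mul_pow, ← hsdef, real_inner_comm x y, ← hd]
    simp only [Real.norm_eq_abs, sq_abs, conj_trivial]
    field_simp
    ring
  have p1 := sq_nonneg ‖ξ - ((a / s) • y + (P * b / Φ) • x)‖
  have p2 := sq_nonneg ‖η - ((b / s) • y - (P * a / Φ) • x)‖
  rw [g1] at p1
  rw [g2] at p2
  have hq : (P / Φ) ^ 2 * (a ^ 2 + b ^ 2) * ‖x‖ ^ 2 ≤ (P / Φ) ^ 2 * (a ^ 2 + b ^ 2) * Φ := by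
    gcongr
  have e1 : (P / Φ) ^ 2 * (a ^ 2 + b ^ 2) * Φ = P ^ 2 / Φ * (a ^ 2 + b ^ 2) := by
    field_simp
  have e2 : (a ^ 2 + b ^ 2) * (1 / s + P ^ 2 / Φ) =
      a * a / s + b * b / s + P ^ 2 / Φ * (a ^ 2 + b ^ 2) := by ring
  rw [e2]
  have e3 : P * b / Φ * (P * b) + P * a / Φ * (P * a) = P ^ 2 / Φ * (a ^ 2 + b ^ 2) := by ring
  have e4 : (P * b / Φ) ^ 2 * ‖x‖ ^ 2 + (P * a / Φ) ^ 2 * ‖x‖ ^ 2 =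
      (P / Φ) ^ 2 * (a ^ 2 + b ^ 2) * ‖x‖ ^ 2 := by ring
  have e5 : 2 * (a / s) * (P * b / Φ) * d = 2 * (b / s) * (P * a / Φ) * d := by ring
  have e6 : a ^ 2 / s = a * a / s := by ring
  have e7 : b ^ 2 / s = b * b / s := by ring
  linarith

/-- If a continuous function `F` is positive on the zero set of a continuous `G ≥ 0`, then
`F + C G` is positive for large `C`, on a compact set. -/
lemma exists_pos_add_mul {X : Type*} [TopologicalSpace X] {T : Set X} (hT : IsCompact T)
    {F G : X → ℝ} (hF : Continuous F) (hG : Continuous G) (hG0 : ∀ x, 0 ≤ G x)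
    (h : ∀ x ∈ T, G x = 0 → 0 < F x) : ∃ C : ℝ, 0 < C ∧ ∀ x ∈ T, 0 < F x + C * G x := by
  have hbad : IsCompact (T ∩ {x | F x ≤ 0}) := hT.inter_right (isClosed_le hF continuous_const)
  rcases (T ∩ {x | F x ≤ 0}).eq_empty_or_nonempty with he | hne
  · refine ⟨1, one_pos, fun x hx => ?_⟩
    have : 0 < F x := by
      by_contra hlt
      exact (he ▸ (⟨hx, not_lt.1 hlt⟩ : x ∈ T ∩ {x | F x ≤ 0}) : x ∈ (∅ : Set X))
    have := hG0 x
    linarith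
  · obtain ⟨p, hp, hpmin⟩ := hbad.exists_isMinOn hne hG.continuousOn
    obtain ⟨q, hq, hqmin⟩ := hbad.exists_isMinOn hne hF.continuousOn
    have hGp : 0 < G p := (hG0 p).lt_of_ne' fun h0 => absurd (h p hp.1 h0) (not_lt.2 hp.2)
    have hFq : F q ≤ 0 := hq.2
    refine ⟨(1 - F q) / G p, by apply div_pos <;> linarith, fun x hx => ?_⟩
    have hc : 0 ≤ (1 - F q) / G p := div_nonneg (by linarith) hGp.le
    rcases le_or_gt (F x) 0 with hle | hlt
    · have h1 : G p ≤ G x := hpmin ⟨hx, hle⟩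
      have h2 : F q ≤ F x := hqmin ⟨hx, hle⟩
      have h3 : (1 - F q) / G p * G p ≤ (1 - F q) / G p * G x := by gcongr
      rw [div_mul_cancel₀ _ hGp.ne'] at h3
      linarith
    · have := mul_nonneg hc (hG0 x)
      linarith

lemma leviQuad_eq_add (C : ℝ) (φ : ℝ → ℝ) (z v : Cn n) :
    leviQuad C φ z v = leviQuad 0 φ z v + C * (leviQuad 1 φ z v - leviQuad 0 φ z v) := by
  simp only [leviQuad]
  ring

/-- Under the first- and second-order inequalities on `φ`, a single `C` makes `expTube C φ` strongly
plurisubharmonic along the whole tube `{|x|² ≤ φ(|y|²)}`. The inequalities give positivity on the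
kernel of `∂(tubeFun φ)`, hence a suitable `C` on the compact part `|y| ≤ R`; beyond it, where `φ`
is affine, every `C ≥ 0` will do. -/
lemma exists_leviQuad_pos {φ : ℝ → ℝ} (hφ : ContDiff ℝ ∞ φ) {R : ℝ}
    (hpos : ∀ s, 0 ≤ s → 0 < φ s) (h1 : ∀ s, 0 ≤ s → deriv φ s < 1)
    (h2 : ∀ s, 0 < s →
      2 * s * deriv (deriv φ) s < (1 - deriv φ s) * (1 + s * deriv φ s ^ 2 / φ s))
    (hR : ∀ s, R ^ 2 < s → deriv (deriv φ) s = 0) :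
    ∃ C : ℝ, 0 < C ∧ ∀ z : Cn n, tubeFun φ z ≤ 0 → ∀ v ∈ Metric.sphere (0 : Cn n) 1,
      0 < leviQuad C φ z v := by
  have hcont := (contDiff_tubeFun (n := n) hφ).continuous
  have hcl : IsClosed {z : Cn n | tubeFun φ z ≤ 0 ∧ ‖imPart z‖ ^ 2 ≤ R ^ 2} :=
    (isClosed_le hcont continuous_const).inter
      (isClosed_le (continuous_imPart.norm.pow 2) continuous_const)
  obtain ⟨B, hB⟩ := (isCompact_Icc (a := (0 : ℝ)) (b := R ^ 2)).bddAbove_image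
    hφ.continuous.continuousOn
  have hcpt : IsCompact {z : Cn n | tubeFun φ z ≤ 0 ∧ ‖imPart z‖ ^ 2 ≤ R ^ 2} := by
    refine Metric.isCompact_of_isClosed_isBounded hcl
      (isBounded_iff_forall_norm_le.2 ⟨√(B + R ^ 2), fun z hz => Real.le_sqrt_of_sq_le ?_⟩)
    have hz1 : ‖rePart z‖ ^ 2 ≤ φ (‖imPart z‖ ^ 2) := sub_nonpos.1 hz.1
    have hz2 : φ (‖imPart z‖ ^ 2) ≤ B := hB ⟨_, ⟨by positivity, hz.2⟩, rfl⟩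
    rw [norm_sq_eq_re_add_im]
    linarith [hz.2]
  have hG0 : ∀ q : Cn n × Cn n, 0 ≤ leviQuad 1 φ q.1 q.2 - leviQuad 0 φ q.1 q.2 := by
    intro q
    have := add_nonneg (sq_nonneg (2 * inner ℝ (rePart q.1) (rePart q.2) -
          2 * deriv φ (‖imPart q.1‖ ^ 2) * inner ℝ (imPart q.1) (imPart q.2)))
        (sq_nonneg (2 * inner ℝ (rePart q.1) (imPart q.2) +
          2 * deriv φ (‖imPart q.1‖ ^ 2) * inner ℝ (imPart q.1) (rePart q.2)))
    simp only [leviQuad]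
    linarith
  have htan : ∀ q ∈ {z : Cn n | tubeFun φ z ≤ 0 ∧ ‖imPart z‖ ^ 2 ≤ R ^ 2} ×ˢ
      Metric.sphere (0 : Cn n) 1, leviQuad 1 φ q.1 q.2 - leviQuad 0 φ q.1 q.2 = 0 →
      0 < leviQuad 0 φ q.1 q.2 := by
    rintro ⟨z, v⟩ ⟨⟨hz, -⟩, hv⟩ hG
    have hv1 : ‖v‖ = 1 := by simpa using hv
    have hz1 : ‖rePart z‖ ^ 2 ≤ φ (‖imPart z‖ ^ 2) := sub_nonpos.1 hz
    have hP := h1 (‖imPart z‖ ^ 2) (by positivity)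
    have hn := norm_sq_eq_re_add_im v
    simp only [leviQuad] at hG ⊢
    have hG' : (2 * inner ℝ (rePart z) (rePart v) -
          2 * deriv φ (‖imPart z‖ ^ 2) * inner ℝ (imPart z) (imPart v)) ^ 2
        + (2 * inner ℝ (rePart z) (imPart v) +
          2 * deriv φ (‖imPart z‖ ^ 2) * inner ℝ (imPart z) (rePart v)) ^ 2 = 0 := by linarith
    obtain ⟨k1, k2⟩ := (add_eq_zero_iff_of_nonneg (sq_nonneg _) (sq_nonneg _)).1 hG'
    rw [sq_eq_zero_iff] at k1 k2
    by_cases hm : inner ℝ (imPart z) (rePart v) ^ 2 + inner ℝ (imPart z) (imPart v) ^ 2 = 0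
    · rw [hm, hv1]
      linarith
    · have hy : imPart z ≠ 0 := fun h0 => hm (by simp [h0])
      have hs : 0 < ‖imPart z‖ ^ 2 := by positivity
      have hΦ := hpos _ hs.le
      have hb := bessel_tangent hy hΦ hz1 (P := deriv φ (‖imPart z‖ ^ 2))
        (ξ := rePart v) (η := imPart v) (by linarith) (by linarith)
      have h2' := h2 _ hs
      rw [← hn] at hb
      set m := inner ℝ (imPart z) (rePart v) ^ 2 + inner ℝ (imPart z) (imPart v) ^ 2 with hmdef
      have hm0 : 0 < m := lt_of_le_of_ne (by positivity) (Ne.symm hm)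
      set s := ‖imPart z‖ ^ 2
      have q1 : (1 - deriv φ s) * (m * (1 / s + deriv φ s ^ 2 / φ s)) ≤
          (1 - deriv φ s) * ‖v‖ ^ 2 := by
        have : 0 ≤ 1 - deriv φ s := by linarith
        gcongr
      have q2 := mul_lt_mul_of_pos_left h2' (div_pos hm0 hs)
      have q3 : m / s * (2 * s * deriv (deriv φ) s) = 2 * deriv (deriv φ) s * m := by
        field_simp
      have q4 : m / s * ((1 - deriv φ s) * (1 + s * deriv φ s ^ 2 / φ s)) =
          (1 - deriv φ s) * (m * (1 / s + deriv φ s ^ 2 / φ s)) := by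
        field_simp
      linarith
  obtain ⟨C, hC, hCpos⟩ := exists_pos_add_mul
    (hcpt.prod (isCompact_sphere (0 : Cn n) 1)) (continuous_leviQuad hφ 0)
    ((continuous_leviQuad hφ 1).sub (continuous_leviQuad hφ 0)) hG0 htan
  refine ⟨C, hC, fun z hz v hv => ?_⟩
  rcases le_or_gt (‖imPart z‖ ^ 2) (R ^ 2) with hle | hlt
  · rw [leviQuad_eq_add]
    exact hCpos (z, v) ⟨⟨hz, hle⟩, hv⟩
  · have hP := h1 (‖imPart z‖ ^ 2) (by positivity)
    have hv1 : ‖v‖ = 1 := by simpa using hv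
    rw [leviQuad, hR _ hlt, hv1]
    have : 0 ≤ C * ((2 * inner ℝ (rePart z) (rePart v) -
        2 * deriv φ (‖imPart z‖ ^ 2) * inner ℝ (imPart z) (imPart v)) ^ 2
      + (2 * inner ℝ (rePart z) (imPart v) +
        2 * deriv φ (‖imPart z‖ ^ 2) * inner ℝ (imPart z) (rePart v)) ^ 2) := by positivity
    linarith

/-! ### The profile function and its inverse -/

lemma mem_setD_iff {lam a : ℝ} {z : Cn n} :
    z ∈ setD n lam a ↔ g lam a ‖rePart z‖ ≤ ‖imPart z‖ := by
  rw [g, Real.sqrt_le_left (norm_nonneg _)]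
  rfl

namespace IsProfile

variable {lam a ε σ : ℝ} {f : ℝ → ℝ}

lemma eps_pos (hf : IsProfile lam a ε σ f) : 0 < ε := hf.sigma_pos.trans hf.sigma_lt

lemma extInv_of_le {u : ℝ} (hu : u ≤ f σ) : extInv σ f u = σ := if_pos hu

lemma extInv_apply (hf : IsProfile lam a ε σ f) {t : ℝ} (ht : σ ≤ t) : extInv σ f (f t) = t := by
  rcases ht.eq_or_lt with rfl | hlt
  · exact extInv_of_le le_rfl
  · have h1 : ¬ f t ≤ f σ := not_le.2 (hf.strictMonoOn self_mem_Ici ht hlt)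
    rw [extInv, if_neg h1]
    exact hf.strictMonoOn.injOn.leftInvOn_invFunOn ht

lemma le_apply (hf : IsProfile lam a ε σ f) (hlam : 1 < lam) (ha : 0 < a) {t : ℝ} (ht : ε ≤ t) :
    t ≤ f t := by
  rw [hf.eq_g t ht, g]
  apply Real.le_sqrt_of_sq_le
  nlinarith [sq_nonneg t]

lemma exists_apply_eq (hf : IsProfile lam a ε σ f) (hlam : 1 < lam) (ha : 0 < a) {u : ℝ}
    (hu : f σ ≤ u) : ∃ t, σ ≤ t ∧ f t = u := by
  have h1 : σ ≤ max u ε := hf.sigma_lt.le.trans (le_max_right _ _)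
  have h2 : u ≤ f (max u ε) := (le_max_left _ _).trans (hf.le_apply hlam ha (le_max_right _ _))
  obtain ⟨t, ht, rfl⟩ := intermediate_value_Icc h1
    (hf.continuousOn.mono Icc_subset_Ici_self) ⟨hu, h2⟩
  exact ⟨t, ht.1, rfl⟩

lemma le_extInv (hf : IsProfile lam a ε σ f) (hlam : 1 < lam) (ha : 0 < a) (u : ℝ) :
    σ ≤ extInv σ f u := by
  rcases le_total u (f σ) with h | h
  · rw [extInv_of_le h]
  · obtain ⟨t, ht, rfl⟩ := hf.exists_apply_eq hlam ha h
    rwa [hf.extInv_apply ht]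

lemma extInv_pos (hf : IsProfile lam a ε σ f) (hlam : 1 < lam) (ha : 0 < a) (u : ℝ) :
    0 < extInv σ f u := hf.sigma_pos.trans_le (hf.le_extInv hlam ha u)

lemma le_extInv_iff (hf : IsProfile lam a ε σ f) (hlam : 1 < lam) (ha : 0 < a) {t u : ℝ}
    (ht : σ < t) : t ≤ extInv σ f u ↔ f t ≤ u := by
  have hft : f σ < f t := hf.strictMonoOn self_mem_Ici ht.le ht
  rcases le_or_gt u (f σ) with h | h
  · rw [extInv_of_le h]
    exact ⟨fun h' => absurd h' (not_le.2 ht), fun h' => absurd (h'.trans h) (not_le.2 hft)⟩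
  · obtain ⟨r, hr, rfl⟩ := hf.exists_apply_eq hlam ha h.le
    rw [hf.extInv_apply hr]
    exact (hf.strictMonoOn.le_iff_le ht.le hr).symm

lemma apply_le_g (hf : IsProfile lam a ε σ f) {t : ℝ} (ht : σ ≤ t) : f t ≤ g lam a t := by
  rcases lt_or_ge t ε with h | h
  · exact (hf.lt_g t ht h).le
  · exact (hf.eq_g t h).le

lemma extInv_eq_of_large (hf : IsProfile lam a ε σ f) (hlam : 1 < lam) {u : ℝ}
    (hu : g lam a ε ≤ u) : extInv σ f u = √((u ^ 2 - a) / lam) := by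
  have hε := hf.eps_pos
  have hu0 : 0 ≤ u := (Real.sqrt_nonneg _).trans hu
  have h1 : lam * ε ^ 2 + a ≤ u ^ 2 := by
    rw [g, Real.sqrt_le_left hu0] at hu
    exact hu
  have h2 : ε ^ 2 ≤ (u ^ 2 - a) / lam := by
    rw [le_div_iff₀ (by linarith)]
    linarith
  have h3 : ε ≤ √((u ^ 2 - a) / lam) := Real.le_sqrt_of_sq_le h2
  have h4 : f (√((u ^ 2 - a) / lam)) = u := by
    rw [hf.eq_g _ h3, g, Real.sq_sqrt ((sq_nonneg _).trans h2), mul_div_cancel₀ _ (by linarith),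
      sub_add_cancel, Real.sqrt_sq hu0]
  conv_lhs => rw [← h4]
  exact hf.extInv_apply (hf.sigma_lt.le.trans h3)

end IsProfile

/-- The function `φ(s) = h(√s)²` with `h = f⁻¹`, so that `K = {|x|² ≤ φ(|y|²)}`. The value
`√s = 0` at negative `s` makes it constant near `(-∞, 0]`. -/
noncomputable def sqProfile (σ : ℝ) (f : ℝ → ℝ) (s : ℝ) : ℝ := extInv σ f (√s) ^ 2

namespace IsProfile

variable {lam a ε σ : ℝ} {f : ℝ → ℝ}

lemma contDiffAt_extInv (hf : IsProfile lam a ε σ f) {u : ℝ} (hu : 0 < u) :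
    ContDiffAt ℝ ∞ (extInv σ f) u := hf.inv_smooth.contDiffAt (Ici_mem_nhds hu)

lemma contDiff_sqProfile (hf : IsProfile lam a ε σ f) : ContDiff ℝ ∞ (sqProfile σ f) := by
  have hσ : 0 < f σ := hf.pos σ self_mem_Ici
  rw [contDiff_iff_contDiffAt]
  intro s
  rcases le_or_gt s 0 with h | h
  · refine (contDiffAt_const (c := σ ^ 2)).congr_of_eventuallyEq ?_
    filter_upwards [Iio_mem_nhds (show s < f σ ^ 2 by nlinarith)] with r hr
    rw [sqProfile, extInv_of_le]
    exact Real.sqrt_le_iff.2 ⟨hσ.le, le_of_lt hr⟩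
  · exact ((hf.contDiffAt_extInv (Real.sqrt_pos.2 h)).comp s (Real.contDiffAt_sqrt h.ne')).pow 2

/-- `φ'(u²) = h(u) h'(u) / u`. -/
lemma deriv_sqProfile (hf : IsProfile lam a ε σ f) {s : ℝ} (hs : 0 < s) :
    deriv (sqProfile σ f) s = extInv σ f (√s) * deriv (extInv σ f) (√s) / √s := by
  have h1 := ((hf.contDiffAt_extInv (Real.sqrt_pos.2 hs)).differentiableAt (by simp)).hasDerivAt
  have h2 := (h1.comp s (Real.hasDerivAt_sqrt hs.ne')).pow 2
  have h3 : HasDerivAt (sqProfile σ f) _ s := h2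
  rw [h3.deriv]
  simp
  ring

lemma deriv_deriv_sqProfile (hf : IsProfile lam a ε σ f) {s : ℝ} (hs : 0 < s) :
    2 * s * deriv (deriv (sqProfile σ f)) s =
      deriv (extInv σ f) (√s) ^ 2 + extInv σ f (√s) * deriv (deriv (extInv σ f)) (√s)
        - extInv σ f (√s) * deriv (extInv σ f) (√s) / √s := by
  have hu := Real.sqrt_pos.2 hs
  have hc := hf.contDiffAt_extInv hu
  have h1 := (hc.differentiableAt (by simp)).hasDerivAt
  have h1' : HasDerivAt (deriv (extInv σ f)) _ (√s) :=
    ((hc.derivWithin (m := 1) (by norm_cast)).differentiableAt (by simp)).hasDerivAt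
  have h2 := ((h1.mul h1').div (hasDerivAt_id (√s)) hu.ne').comp s (Real.hasDerivAt_sqrt hs.ne')
  have h3 : deriv (sqProfile σ f) =ᶠ[𝓝 s]
      (fun u => extInv σ f u * deriv (extInv σ f) u / u) ∘ Real.sqrt := by
    filter_upwards [Ioi_mem_nhds hs] with r hr
    exact hf.deriv_sqProfile hr
  have h4 : HasDerivAt (deriv (sqProfile σ f)) _ s := h2.congr_of_eventuallyEq h3
  rw [h4.deriv]
  nth_rw 1 [← Real.sq_sqrt hs.le]
  simp
  field_simp

lemma sqProfile_pos (hf : IsProfile lam a ε σ f) (hlam : 1 < lam) (ha : 0 < a) (s : ℝ) :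
    0 < sqProfile σ f s := pow_pos (hf.extInv_pos hlam ha _) 2

lemma deriv_sqProfile_lt_one (hf : IsProfile lam a ε σ f) {s : ℝ} (hs : 0 ≤ s) :
    deriv (sqProfile σ f) s < 1 := by
  rcases hs.eq_or_lt with rfl | hs
  · have hσ : 0 < f σ := hf.pos σ self_mem_Ici
    have h : sqProfile σ f =ᶠ[𝓝 0] fun _ => σ ^ 2 := by
      filter_upwards [Iio_mem_nhds (show 0 < f σ ^ 2 by positivity)] with r hr
      rw [sqProfile, extInv_of_le]
      exact Real.sqrt_le_iff.2 ⟨hσ.le, le_of_lt hr⟩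
    rw [h.deriv_eq]
    simp
  · rw [hf.deriv_sqProfile hs]
    exact hf.inv_ineq_first _ (Real.sqrt_pos.2 hs)

/-- The second-order inequality `h (h'' + h'³ / u) < 1` for `h = f⁻¹`, in terms of `φ`. -/
lemma sqProfile_curvature (hf : IsProfile lam a ε σ f) (hlam : 1 < lam) (ha : 0 < a) {s : ℝ}
    (hs : 0 < s) : 2 * s * deriv (deriv (sqProfile σ f)) s < (1 - deriv (sqProfile σ f) s) *
      (1 + s * deriv (sqProfile σ f) s ^ 2 / sqProfile σ f s) := by
  have hu := Real.sqrt_pos.2 hs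
  have h := hf.inv_ineq_second _ hu
  have hh := hf.extInv_pos hlam ha (√s)
  have hs2 : s = √s ^ 2 := (Real.sq_sqrt hs.le).symm
  rw [hf.deriv_deriv_sqProfile hs, hf.deriv_sqProfile hs, sqProfile]
  set u := √s
  set k := extInv σ f u
  set k' := deriv (extInv σ f) u
  have e1 : s * (k * k' / u) ^ 2 / k ^ 2 = k' ^ 2 := by
    rw [hs2]
    field_simp
  rw [e1]
  have e2 : (1 - k * k' / u) * (1 + k' ^ 2) = 1 - k * k' / u + k' ^ 2 - k * (k' ^ 3 / u) := by ring
  rw [e2]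
  linarith

lemma deriv_deriv_sqProfile_of_large (hf : IsProfile lam a ε σ f) (hlam : 1 < lam) (ha : 0 < a)
    {s : ℝ} (hs : g lam a ε ^ 2 < s) : deriv (deriv (sqProfile σ f)) s = 0 := by
  have h : ∀ r, g lam a ε ^ 2 < r → sqProfile σ f r = lam⁻¹ * r + -(a / lam) := by
    intro r hr
    have hr0 : 0 ≤ r := (sq_nonneg _).trans hr.le
    have hga : g lam a ε ^ 2 = lam * ε ^ 2 + a := Real.sq_sqrt (by positivity)
    rw [sqProfile, hf.extInv_eq_of_large hlam (Real.le_sqrt_of_sq_le hr.le), Real.sq_sqrt hr0,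
      Real.sq_sqrt]
    · ring
    · apply div_nonneg _ (by linarith)
      nlinarith [sq_nonneg ε]
  have h1 : ∀ r, g lam a ε ^ 2 < r → deriv (sqProfile σ f) r = lam⁻¹ := by
    intro r hr
    have : sqProfile σ f =ᶠ[𝓝 r] fun r => lam⁻¹ * r + -(a / lam) := by
      filter_upwards [Ioi_mem_nhds hr] with t ht using h t ht
    rw [this.deriv_eq]
    simp
  have h2 : deriv (sqProfile σ f) =ᶠ[𝓝 s] fun _ => lam⁻¹ := by
    filter_upwards [Ioi_mem_nhds hs] with t ht using h1 t ht
  rw [h2.deriv_eq]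
  simp

lemma setK_eq (hf : IsProfile lam a ε σ f) (hlam : 1 < lam) (ha : 0 < a) :
    setK n σ f = {z | tubeFun (sqProfile σ f) z ≤ 0} := by
  ext z
  simp only [setK, mem_ofPred_eq, tubeFun, sqProfile, sub_nonpos, Real.sqrt_sq (norm_nonneg _)]
  exact (sq_le_sq₀ (norm_nonneg _) (hf.extInv_pos hlam ha _).le).symm

lemma isStronglyPseudoconvexDomain_setK (hf : IsProfile lam a ε σ f) (hlam : 1 < lam)
    (ha : 0 < a) : IsStronglyPseudoconvexDomain (setK n σ f) := by
  have hφ := hf.contDiff_sqProfile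
  obtain ⟨C, hC, hpos⟩ := exists_leviQuad_pos (n := n) hφ (fun s _ => hf.sqProfile_pos hlam ha s)
    (fun s hs => hf.deriv_sqProfile_lt_one hs) (fun s hs => hf.sqProfile_curvature hlam ha hs)
    (fun s hs => hf.deriv_deriv_sqProfile_of_large hlam ha hs)
  rw [hf.setK_eq hlam ha]
  refine isStronglyPseudoconvexDomain_tube hφ hC (fun z hz h0 => ?_) hpos
  -- the radial derivative in `x` does not vanish, as `|x|² = φ(|y|²) > 0`
  have h1 := fderiv_tubeFun hφ z (ofRealL n (rePart z))
  have h2 := hf.sqProfile_pos hlam ha (‖imPart z‖ ^ 2)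
  have h3 : ‖rePart z‖ ^ 2 = sqProfile σ f (‖imPart z‖ ^ 2) := sub_eq_zero.1 hz
  rw [h0, rePart_ofRealL, imPart_ofRealL, real_inner_self_eq_norm_sq] at h1
  simp only [zero_apply, inner_zero_right, mul_zero, sub_zero] at h1
  linarith

lemma mem_setK_iff (hf : IsProfile lam a ε σ f) (hlam : 1 < lam) (ha : 0 < a) {z : Cn n} :
    z ∈ setK n σ f ↔ ‖rePart z‖ ≤ σ ∨ f ‖rePart z‖ ≤ ‖imPart z‖ := by
  rcases le_or_gt ‖rePart z‖ σ with h | h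
  · exact iff_of_true (h.trans (hf.le_extInv hlam ha _)) (Or.inl h)
  · rw [or_iff_right (not_le.2 h), ← hf.le_extInv_iff hlam ha h]
    rfl

lemma setD_union_subset_setK (hf : IsProfile lam a ε σ f) (hlam : 1 < lam) (ha : 0 < a) :
    setD n lam a ∪ {z | ‖rePart z‖ ≤ σ} ⊆ setK n σ f := by
  rintro z (hz | hz)
  · rw [hf.mem_setK_iff hlam ha]
    rcases le_or_gt ‖rePart z‖ σ with h | h
    · exact Or.inl h
    · exact Or.inr ((hf.apply_le_g h.le).trans (mem_setD_iff.1 hz))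
  · exact (hf.mem_setK_iff hlam ha).2 (Or.inl hz)

lemma setK_subset_setD_union (hf : IsProfile lam a ε σ f) (hlam : 1 < lam) (ha : 0 < a) :
    setK n σ f ⊆ setD n lam a ∪ {z | ‖rePart z‖ < ε} := by
  intro z hz
  rcases lt_or_ge ‖rePart z‖ ε with h | h
  · exact Or.inr h
  · rcases (hf.mem_setK_iff hlam ha).1 hz with h' | h'
    · exact absurd (h.trans h') (not_le.2 hf.sigma_lt)
    · exact Or.inl (mem_setD_iff.2 (hf.eq_g _ h ▸ h'))

end IsProfile

/-! ### The domain and the handle -/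

/-- The function `φ` with `D = {|x|² ≤ φ(|y|²)}`. -/
noncomputable def affineProfile (lam a s : ℝ) : ℝ := lam⁻¹ * s + -(a / lam)

lemma contDiff_affineProfile (lam a : ℝ) : ContDiff ℝ ∞ (affineProfile lam a) := by
  unfold affineProfile
  fun_prop

lemma deriv_affineProfile (lam a : ℝ) : deriv (affineProfile lam a) = fun _ => lam⁻¹ := by
  funext s
  unfold affineProfile
  simp

lemma setD_eq {lam : ℝ} (hlam : 1 < lam) (a : ℝ) :
    setD n lam a = {z | tubeFun (affineProfile lam a) z ≤ 0} := by
  have h0 : 0 < lam := by linarith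
  ext z
  have : lam⁻¹ * ‖imPart z‖ ^ 2 + -(a / lam) = (‖imPart z‖ ^ 2 - a) / lam := by ring
  rw [setD, mem_ofPred_eq, mem_ofPred_eq, tubeFun, affineProfile, sub_nonpos, this,
    le_div_iff₀ h0]
  constructor <;> intro h <;> linarith

lemma fderiv_tubeFun_affineProfile_ne_zero {lam a : ℝ} (hlam : 1 < lam) (ha : 0 < a) (z : Cn n)
    (hz : tubeFun (affineProfile lam a) z = 0) :
    fderiv ℝ (tubeFun (affineProfile lam a)) z ≠ 0 := by
  intro h0
  have hl : 0 < lam := by linarith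
  -- the radial derivative in `y` does not vanish, as `|y|² ≥ a > 0`
  have h1 := fderiv_tubeFun (contDiff_affineProfile lam a) z
    (Complex.I • ofRealL n (imPart z))
  rw [h0, rePart_I_smul, imPart_I_smul, rePart_ofRealL, imPart_ofRealL, deriv_affineProfile,
    real_inner_self_eq_norm_sq] at h1
  simp only [zero_apply, neg_zero, inner_zero_right, mul_zero, zero_sub] at h1
  have h2 : ‖rePart z‖ ^ 2 = lam⁻¹ * ‖imPart z‖ ^ 2 + -(a / lam) := sub_eq_zero.1 hz
  have h3 : 0 < a / lam := div_pos ha hl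
  nlinarith [sq_nonneg ‖rePart z‖]

lemma isStronglyPseudoconvexDomain_setD {lam a : ℝ} (hlam : 1 < lam) (ha : 0 < a) :
    IsStronglyPseudoconvexDomain (setD n lam a) := by
  rw [setD_eq hlam]
  refine isStronglyPseudoconvexDomain_tube (contDiff_affineProfile lam a) one_pos
    (fderiv_tubeFun_affineProfile_ne_zero hlam ha) fun z _ v hv => ?_
  have hv1 : ‖v‖ = 1 := by simpa using hv
  have hl : lam⁻¹ < 1 := inv_lt_one_of_one_lt₀ hlam
  rw [leviQuad, hv1]
  simp only [deriv_affineProfile, deriv_const]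
  have := add_nonneg (sq_nonneg (2 * inner ℝ (rePart z) (rePart v) -
      2 * lam⁻¹ * inner ℝ (imPart z) (imPart v)))
    (sq_nonneg (2 * inner ℝ (rePart z) (imPart v) +
      2 * lam⁻¹ * inner ℝ (imPart z) (rePart v)))
  linarith

/-- The sphere `{iy : |y| = √a}`, both the boundary of the handle and its intersection with `D`. -/
def handleBoundary (n : ℕ) (a : ℝ) : Set (Cn n) := {z | rePart z = 0 ∧ ‖imPart z‖ ^ 2 = a}

lemma mem_setM_iff {a : ℝ} (ha : 0 < a) {z : Cn n} :
    z ∈ setM n a ↔ rePart z = 0 ∧ ‖imPart z‖ ^ 2 ≤ a := by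
  rw [setM, mem_ofPred_eq, Real.le_sqrt (norm_nonneg _) ha.le]

lemma fderiv_imPart_norm_sq (a : ℝ) (z v : Cn n) :
    fderiv ℝ (fun z : Cn n => ‖imPart z‖ ^ 2 - a) z v = 2 * inner ℝ (imPart z) (imPart v) := by
  have h : HasFDerivAt (fun z : Cn n => ‖imPart z‖ ^ 2 - a) _ z :=
    ((imL n).hasFDerivAt (x := z)).norm_sq.sub_const a
  rw [h.fderiv]
  simp

lemma isTotallyRealHandle_setM {lam a : ℝ} (hlam : 1 < lam) (ha : 0 < a) :
    IsTotallyRealHandle (setD n lam a) (setM n a) (handleBoundary n a) := by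
  have hfd : ∀ z : Cn n, fderiv ℝ (rePart : Cn n → _) z = reL n := fun z => (reL n).fderiv
  have hsub : handleBoundary n a ⊆ setM n a := fun z hz => (mem_setM_iff ha).2 ⟨hz.1, hz.2.le⟩
  have hdef : IsLocalDefiningFunction (setD n lam a) univ (tubeFun (affineProfile lam a)) :=
    ⟨isOpen_univ, (contDiff_tubeFun (contDiff_affineProfile lam a)).contDiffOn,
      by simp [setD_eq hlam], fun z _ => fderiv_tubeFun_affineProfile_ne_zero hlam ha z⟩
  refine ⟨n, handleBoundary n a, hsub, Subset.rfl, fun p _ => connectedComponentIn_subset _ _,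
    ?_, ?_, fun p _ => ⟨univ, rePart, fun z => ‖imPart z‖ ^ 2 - a, mem_univ p, ⟨isOpen_univ,
      (reL n).contDiff.contDiffOn, (((imL n).contDiff.norm_sq ℝ).sub contDiff_const).contDiffOn,
      ?_, ?_, ?_, ?_⟩, ?_, fun hp => ⟨univ, _, mem_univ p, hdef, ?_⟩⟩⟩
  · ext z
    rw [mem_inter_iff, mem_setM_iff ha]
    constructor
    · rintro ⟨⟨h1, h2⟩, h3⟩
      simp only [setD, mem_ofPred_eq, h1, norm_zero] at h3
      exact ⟨h1, by linarith⟩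
    · rintro ⟨h1, h2⟩
      refine ⟨⟨h1, h2.le⟩, ?_⟩
      simp [setD, h1, h2]
  · intro z hz
    rw [setD_eq hlam, frontier_sublevel_eq (contDiff_tubeFun (contDiff_affineProfile lam a)).continuous
      (fderiv_tubeFun_affineProfile_ne_zero hlam ha), mem_ofPred_eq, tubeFun, hz.1, hz.2,
      affineProfile, norm_zero]
    ring
  · ext z
    simp [mem_setM_iff ha]
  · ext z
    simp [handleBoundary, sub_eq_zero]
  · intro z _ x
    rw [hfd]
    exact ⟨ofRealL n x, rePart_ofRealL x⟩
  · rintro z ⟨hz, -⟩ ⟨x, c⟩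
    have hza : inner ℝ (imPart z) (imPart z) = a := by rw [real_inner_self_eq_norm_sq, hz.2]
    refine ⟨ofRealL n x + Complex.I • ofRealL n ((c / (2 * a)) • imPart z), Prod.ext ?_ ?_⟩
    · have h := map_add (reL n) (ofRealL n x) (Complex.I • ofRealL n ((c / (2 * a)) • imPart z))
      simp only [reL_apply, rePart_I_smul, rePart_ofRealL, imPart_ofRealL, neg_zero,
        add_zero] at h
      simpa [hfd] using h
    · have h := map_add (imL n) (ofRealL n x) (Complex.I • ofRealL n ((c / (2 * a)) • imPart z))
      simp only [imL_apply, imPart_I_smul, rePart_ofRealL, imPart_ofRealL, zero_add] at h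
      rw [ContinuousLinearMap.prod_apply, fderiv_imPart_norm_sq, h, inner_smul_right, hza]
      field_simp
  · intro v h1 h2
    rw [hfd, reL_apply] at h1 h2
    rw [rePart_I_smul, neg_eq_zero] at h2
    exact ext_re_im (h1.trans (map_zero (reL n)).symm) (h2.trans (map_zero (imL n)).symm)
  · intro v h1 h2
    rw [hfd, reL_apply] at h1
    rw [fderiv_imPart_norm_sq] at h2
    have h3 : inner ℝ (imPart p) (imPart v) = 0 := by linarith
    rw [fderiv_tubeFun (contDiff_affineProfile lam a), fderiv_tubeFun (contDiff_affineProfile lam a),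
      imPart_I_smul, h1, hp.1, h3]
    simp

/-! ### The deformation retraction -/

/-- The radius of the slice of `D ∪ M` over `y`, as a function of `u = |y|`. For
`u² < a` the square root of a negative number is `0`, and the slice is that of `M`. -/
noncomputable def centerRadius (lam a u : ℝ) : ℝ := √((u ^ 2 - a) / lam)

lemma mem_center_iff {lam a : ℝ} (hlam : 1 < lam) (ha : 0 < a) {z : Cn n} :
    z ∈ setD n lam a ∪ setM n a ↔ ‖rePart z‖ ≤ centerRadius lam a ‖imPart z‖ := by
  have hl : 0 < lam := by linarith
  rw [mem_union, mem_setM_iff ha, setD, mem_ofPred_eq, centerRadius]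
  rcases le_or_gt a (‖imPart z‖ ^ 2) with h | h
  · have h0 : 0 ≤ (‖imPart z‖ ^ 2 - a) / lam := div_nonneg (by linarith) hl.le
    rw [Real.le_sqrt (norm_nonneg _) h0, le_div_iff₀ hl]
    constructor
    · rintro (h1 | ⟨h1, h2⟩)
      · linarith
      · rw [h1, norm_zero]
        linarith
    · intro h1
      left
      linarith
  · rw [Real.sqrt_eq_zero_of_nonpos (div_nonpos_of_nonpos_of_nonneg (by linarith) hl.le),
      norm_le_zero_iff, or_iff_right, and_iff_left h.le]
    have : 0 ≤ lam * ‖rePart z‖ ^ 2 := by positivity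
    linarith

/-- The part of `x` beyond the ball of radius `r`. It equals `0` at `x = 0` for `r = 0`, where the
quotient is `0 / 0`. -/
noncomputable def excess {E : Type*} [NormedAddCommGroup E] [NormedSpace ℝ E] (r : ℝ) (x : E) : E :=
  ((max r ‖x‖ - r) / max r ‖x‖) • x

section Excess

variable {E : Type*} [NormedAddCommGroup E]

lemma excess_coeff_mem {r : ℝ} (hr : 0 ≤ r) (x : E) :
    (max r ‖x‖ - r) / max r ‖x‖ ∈ Icc (0 : ℝ) 1 :=
  ⟨div_nonneg (by simp) (hr.trans (le_max_left _ _)),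
    div_le_one_of_le₀ (by linarith) (hr.trans (le_max_left _ _))⟩

variable [NormedSpace ℝ E]

lemma excess_eq_zero {r : ℝ} {x : E} (hx : ‖x‖ ≤ r) : excess r x = 0 := by
  simp [excess, max_eq_left hx]

lemma norm_sub_smul_excess_le {r t : ℝ} (hr : 0 ≤ r) (ht : t ∈ Icc (0 : ℝ) 1) (x : E) :
    ‖x - t • excess r x‖ ≤ ‖x‖ := by
  obtain ⟨h1, h2⟩ := excess_coeff_mem hr x
  have h : x - t • excess r x = (1 - t * ((max r ‖x‖ - r) / max r ‖x‖)) • x := by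
    rw [excess, smul_smul, sub_smul, one_smul]
  have h3 := mul_nonneg ht.1 h1
  have h4 := mul_le_one₀ ht.2 h1 h2
  rw [h, norm_smul, Real.norm_of_nonneg (by linarith)]
  exact mul_le_of_le_one_left (norm_nonneg _) (by linarith)

lemma norm_sub_excess_le {r : ℝ} (hr : 0 ≤ r) (x : E) : ‖x - excess r x‖ ≤ r := by
  rcases le_or_gt ‖x‖ r with h | h
  · rwa [excess_eq_zero h, sub_zero]
  · have hx : 0 < ‖x‖ := hr.trans_lt h
    have e : x - excess r x = (r / ‖x‖) • x := by
      rw [excess, max_eq_right h.le, sub_div, div_self hx.ne', sub_smul, one_smul, sub_sub_cancel]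
    rw [e, norm_smul, Real.norm_of_nonneg (by positivity), div_mul_cancel₀ _ hx.ne']

/-- At points with `r = 0` and `x = 0`, continuity follows from `‖excess r x‖ ≤ ‖x‖`. -/
lemma continuous_excess {X : Type*} [TopologicalSpace X] {r : X → ℝ} {x : X → E}
    (hr : Continuous r) (hx : Continuous x) (hr0 : ∀ p, 0 ≤ r p) :
    Continuous fun p => excess (r p) (x p) := by
  have hm : Continuous fun p => max (r p) ‖x p‖ := hr.max hx.norm
  rw [continuous_iff_continuousAt]
  intro p
  by_cases h : max (r p) ‖x p‖ = 0
  · have hxp : x p = 0 := norm_le_zero_iff.1 (h ▸ le_max_right _ _)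
    have h0 : excess (r p) (x p) = 0 := by rw [excess, hxp, smul_zero]
    rw [ContinuousAt, h0]
    refine squeeze_zero_norm (a := fun q => ‖x q‖) (fun q => ?_) ?_
    · obtain ⟨h1, h2⟩ := excess_coeff_mem (hr0 q) (x q)
      rw [excess, norm_smul, Real.norm_of_nonneg h1]
      exact mul_le_of_le_one_left (norm_nonneg _) h2
    · simpa [hxp] using (hx.norm.tendsto p)
  · exact (((hm.sub hr).continuousAt).div hm.continuousAt h).smul hx.continuousAt

end Excess

/-- The retraction shrinks `x` linearly to its projection on the ball over `y` contained in
`D ∪ M`, and fixes `y`. -/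
lemma stronglyDeformationRetractsOnto_center {lam a : ℝ} (hlam : 1 < lam) (ha : 0 < a)
    {h : ℝ → ℝ} (hsub : setD n lam a ∪ setM n a ⊆ {z | ‖rePart z‖ ≤ h ‖imPart z‖}) :
    StronglyDeformationRetractsOnto {z : Cn n | ‖rePart z‖ ≤ h ‖imPart z‖}
      (setD n lam a ∪ setM n a) := by
  have hr0 : ∀ z : Cn n, 0 ≤ centerRadius lam a ‖imPart z‖ := fun z => Real.sqrt_nonneg _
  have hrc : Continuous fun z : Cn n => centerRadius lam a ‖imPart z‖ := by
    have := continuous_imPart (n := n)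
    unfold centerRadius
    fun_prop
  set p : Cn n → EuclideanSpace ℝ (Fin n) :=
    fun z => excess (centerRadius lam a ‖imPart z‖) (rePart z) with hp
  have hpc : Continuous p := continuous_excess hrc continuous_rePart hr0
  have hre : ∀ (t : ℝ) (z : Cn n), rePart (z - t • ofRealL n (p z)) = rePart z - t • p z :=
    fun t z => by
      rw [← reL_apply, map_sub, map_smul, reL_apply, reL_apply, rePart_ofRealL]
  have him : ∀ (t : ℝ) (z : Cn n), imPart (z - t • ofRealL n (p z)) = imPart z :=
    fun t z => by
      rw [← imL_apply, map_sub, map_smul, imL_apply, imL_apply, imPart_ofRealL, smul_zero, sub_zero]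
  refine ⟨hsub, fun q => q.2 - q.1 • ofRealL n (p q.2), ?_, ?_, ?_, ?_, ?_⟩
  · have := (ofRealL n).continuous.comp hpc
    exact (continuous_snd.sub (continuous_fst.smul (this.comp continuous_snd))).continuousOn
  · intro t ht z hz
    rw [mem_ofPred_eq, hre, him]
    exact (norm_sub_smul_excess_le (hr0 z) ht _).trans hz
  · intro z _
    simp
  · intro z _
    rw [mem_center_iff hlam ha, hre, him, one_smul]
    exact norm_sub_excess_le (hr0 z) _
  · intro t _ z hz
    rw [mem_center_iff hlam ha] at hz
    simp [hp, excess_eq_zero hz]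

end Handlebody

theorem corollary3p2 (n : ℕ) (lam a ε σ : ℝ) (hlam : 1 < lam) (ha : 0 < a) (f : ℝ → ℝ)
    (hf : Handlebody.IsProfile lam a ε σ f) :
    Handlebody.IsStronglyPseudoconvexHandlebody (Handlebody.setD n lam a) (Handlebody.setM n a)
      {z | ‖Handlebody.rePart z‖ < ε} (Handlebody.setK n σ f) ∧
    Handlebody.setD n lam a ∪ {z | ‖Handlebody.rePart z‖ ≤ σ} ⊆ Handlebody.setK n σ f ∧
    Handlebody.setK n σ f ⊆ Handlebody.setD n lam a ∪ {z | ‖Handlebody.rePart z‖ < ε} := by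
  have hDK := hf.setD_union_subset_setK (n := n) hlam ha
  have hKD := hf.setK_subset_setD_union (n := n) hlam ha
  have hcenter : Handlebody.setD n lam a ∪ Handlebody.setM n a ⊆ Handlebody.setK n σ f := by
    refine (union_subset_union_right _ fun z hz => ?_).trans hDK
    rw [mem_ofPred_eq, hz.1, norm_zero]
    exact hf.sigma_pos.le
  refine ⟨⟨Handlebody.isStronglyPseudoconvexDomain_setD hlam ha,
    ⟨_, Handlebody.isTotallyRealHandle_setM hlam ha⟩,
    isOpen_lt Handlebody.continuous_rePart.norm continuous_const, fun z hz => ?_,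
    hf.isStronglyPseudoconvexDomain_setK hlam ha, hcenter, hKD,
    Handlebody.stronglyDeformationRetractsOnto_center hlam ha hcenter⟩, hDK, hKD⟩
  rw [mem_ofPred_eq, hz.1, norm_zero]
  exact hf.eps_pos
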